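/- Let $X$ and $Y$ be real Banach spaces. Write $B_E$, $S_E$ for the closed unit ball and the unit sphere of a Banach space $E$, and regard $E$ as canonically embedded in $E^{**}$. A point $f\in S_{E^*}$ is called a weak*-strongly extreme point of $B_{E^*}$ if the weak*-slices $\{g\in B_{E^*}: g(e)>\sup_{h\in B_{E^*}}h(e)-\alpha\}$ ($e\in E$, $\alpha>0$) that contain $f$ form a local base at $f$ for the weak topology $\sigma(E^*,E^{**})$ on $B_{E^*}$; the set of these points is denoted by $w^*\text{-}\mathrm{strext}(B_{E^*})$. Let $\mathcal L(X,Y^*)$ be the space of bounded linear operators and $\mathcal K(X,Y^*)$ its subspace of compact operators, and let $T\in\mathcal L(X,Y^*)$ act on the projective tensor product $X\hat\otimes_\pi Y$ as the bounded linear functional determined by $T(x\otimes y)=(Tx)(y)$. For $x\in X$ and $y\in Y$ regard $x\otimes y$ as the element $T\mapsto (Tx)(y)$ of $\mathcal L(X,Y^*)^*$, and, more generally, for $\varphi\in X^{**}$ and $\psi\in Y^{**}$ let $\varphi\otimes\psi\in\mathcal L(X,Y^*)^*$ be $T\mapsto\varphi(\psi\circ T)$; for subsets $A$, $B$ put $A\otimes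 B=\{a\otimes b: a\in A,\ b\in B\}$. Suppose that $\mathcal K(X,Y^*)$ separates the points of $X\hat\otimes_\pi Y$. Then for every weak*-strongly extreme point $z$ of $B_{\mathcal L(X,Y^*)^*}$ there are $x\in S_X$ and $y\in S_Y$ such that $z=x\otimes y$, $x$ is a weak*-strongly extreme point of $B_{X^{**}}$, and $y$ is a weak*-strongly extreme point of $B_{Y^{**}}$. Moreover, $$w^*\text{-}\mathrm{strext}(B_{\mathcal L(X,Y^*)^*})\subset w^*\text{-}\mathrm{strext}(B_{X^{**}})\otimes w^*\text{-}\mathrm{strext}(B_{Y^{**}})\subset B_X\otimes B_Y .$$ -/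

import Mathlib

open scoped TensorProduct Topology

set_option linter.unusedSectionVars false

noncomputable section

/-! ### The projective tensor product of two real normed spaces -/

/-- The algebraic tensor product `X ⊗ Y`, as a type synonym that carries the projective norm. -/
def ProjAlgTensor (X Y : Type*) [NormedAddCommGroup X] [NormedSpace ℝ X]
    [NormedAddCommGroup Y] [NormedSpace ℝ Y] : Type _ :=
  X ⊗[ℝ] Y

namespace ProjAlgTensor

variable {X Y : Type*} [NormedAddCommGroup X] [NormedSpace ℝ X]
  [NormedAddCommGroup Y] [NormedSpace ℝ Y]

instance : AddCommGroup (ProjAlgTensor X Y) := inferInstanceAs (AddCommGroup (X ⊗[ℝ] Y))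

instance : Module ℝ (ProjAlgTensor X Y) := inferInstanceAs (Module ℝ (X ⊗[ℝ] Y))

/-- The elementary tensor `x ⊗ y` in the algebraic tensor product. -/
def mk (x : X) (y : Y) : ProjAlgTensor X Y := (x ⊗ₜ[ℝ] y : X ⊗[ℝ] Y)

/-- The tensor `∑ xᵢ ⊗ yᵢ` that a finite list of pairs `(xᵢ, yᵢ)` represents. -/
def ofList (l : List (X × Y)) : ProjAlgTensor X Y := (l.map fun p => mk p.1 p.2).sum

/-- The cost `∑ ‖xᵢ‖ ‖yᵢ‖` of a finite list of pairs `(xᵢ, yᵢ)`. -/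
def cost (l : List (X × Y)) : ℝ := (l.map fun p => ‖p.1‖ * ‖p.2‖).sum

lemma cost_nonneg (l : List (X × Y)) : 0 ≤ cost l := by
  refine List.sum_nonneg fun a ha => ?_
  obtain ⟨p, -, rfl⟩ := List.mem_map.1 ha
  positivity

lemma ofList_append (l m : List (X × Y)) : ofList (l ++ m) = ofList l + ofList m := by
  simp [ofList]

lemma cost_append (l m : List (X × Y)) : cost (l ++ m) = cost l + cost m := by
  simp [cost]

lemma ofList_smul (a : ℝ) (l : List (X × Y)) :
    ofList (l.map fun p => (a • p.1, p.2)) = a • ofList l := by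
  induction l with
  | nil => simp [ofList]
  | cons p l ih =>
    simp only [ofList, List.map_cons, List.sum_cons, smul_add] at ih ⊢
    rw [ih]
    congr 1

lemma cost_smul (a : ℝ) (l : List (X × Y)) :
    cost (l.map fun p => (a • p.1, p.2)) = ‖a‖ * cost l := by
  induction l with
  | nil => simp [cost]
  | cons p l ih =>
    simp only [cost, List.map_cons, List.sum_cons, norm_smul, mul_add] at ih ⊢
    rw [ih, mul_assoc]

lemma exists_ofList (u : ProjAlgTensor X Y) : ∃ l : List (X × Y), ofList l = u := by
  induction u using TensorProduct.induction_on with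
  | zero => exact ⟨[], rfl⟩
  | tmul x y => exact ⟨[(x, y)], add_zero (mk x y)⟩
  | add u v hu hv =>
    obtain ⟨l, hl⟩ := hu
    obtain ⟨m, hm⟩ := hv
    exact ⟨l ++ m, by rw [ofList_append, hl, hm]; rfl⟩

/-- The projective norm `‖u‖_π = inf {∑ ‖xᵢ‖ ‖yᵢ‖ : u = ∑ xᵢ ⊗ yᵢ}`. -/
def projNorm (u : ProjAlgTensor X Y) : ℝ :=
  sInf {r | ∃ l : List (X × Y), ofList l = u ∧ cost l = r}

lemma projNorm_le (l : List (X × Y)) : projNorm (ofList l) ≤ cost l :=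
  csInf_le ⟨0, by rintro _ ⟨m, -, rfl⟩; exact cost_nonneg m⟩ ⟨l, rfl, rfl⟩

lemma le_projNorm {u : ProjAlgTensor X Y} {c : ℝ}
    (h : ∀ l : List (X × Y), ofList l = u → c ≤ cost l) : c ≤ projNorm u := by
  obtain ⟨l, hl⟩ := exists_ofList u
  refine le_csInf ⟨cost l, l, hl, rfl⟩ ?_
  rintro _ ⟨m, hm, rfl⟩
  exact h m hm

lemma exists_cost_lt (u : ProjAlgTensor X Y) {ε : ℝ} (hε : 0 < ε) :
    ∃ l : List (X × Y), ofList l = u ∧ cost l < projNorm u + ε := by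
  by_contra! h
  exact absurd (le_projNorm h) (by linarith)

lemma projNorm_nonneg (u : ProjAlgTensor X Y) : 0 ≤ projNorm u :=
  le_projNorm fun l _ => cost_nonneg l

/-- The projective norm, bundled as a seminorm. -/
def projSeminorm : Seminorm ℝ (ProjAlgTensor X Y) :=
  Seminorm.ofSMulLE projNorm
    (le_antisymm (by simpa [ofList, cost] using projNorm_le ([] : List (X × Y)))
      (projNorm_nonneg _))
    (fun u v => by
      refine le_of_forall_pos_le_add fun ε hε => ?_
      obtain ⟨l, hl, hl'⟩ := exists_cost_lt u (half_pos hε)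
      obtain ⟨m, hm, hm'⟩ := exists_cost_lt v (half_pos hε)
      have := projNorm_le (l ++ m)
      rw [ofList_append, cost_append, hl, hm] at this
      linarith)
    (fun a u => by
      refine le_of_forall_pos_le_add fun ε hε => ?_
      have ha : 0 < ‖a‖ + 1 := by positivity
      obtain ⟨l, hl, hl'⟩ := exists_cost_lt u (div_pos hε ha)
      have h := projNorm_le (l.map fun p => (a • p.1, p.2))
      rw [ofList_smul, cost_smul, hl] at h
      have h1 : ‖a‖ * cost l ≤ ‖a‖ * (projNorm u + ε / (‖a‖ + 1)) :=
        mul_le_mul_of_nonneg_left hl'.le (norm_nonneg a)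
      have h2 : ‖a‖ * (ε / (‖a‖ + 1)) ≤ ε := by
        rw [← mul_div_assoc, div_le_iff₀ ha]
        nlinarith
      linarith)

instance : SeminormedAddCommGroup (ProjAlgTensor X Y) :=
  projSeminorm.toAddGroupSeminorm.toSeminormedAddCommGroup

lemma norm_eq (u : ProjAlgTensor X Y) : ‖u‖ = projNorm u := rfl

instance : NormedSpace ℝ (ProjAlgTensor X Y) where
  norm_smul_le a u := (map_smul_eq_mul projSeminorm a u).le

/-- The linear functional `∑ xᵢ ⊗ yᵢ ↦ ∑ (T xᵢ)(yᵢ)` on the algebraic tensor product. -/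
def pairLin (T : X →L[ℝ] StrongDual ℝ Y) : ProjAlgTensor X Y →ₗ[ℝ] ℝ :=
  TensorProduct.lift (LinearMap.mk₂ ℝ (fun x y => T x y)
    (by simp) (by simp) (by simp) (by simp) : X →ₗ[ℝ] Y →ₗ[ℝ] ℝ)

lemma pairLin_mk (T : X →L[ℝ] StrongDual ℝ Y) (x : X) (y : Y) : pairLin T (mk x y) = T x y :=
  TensorProduct.lift.tmul x y

lemma norm_pairLin_le (T : X →L[ℝ] StrongDual ℝ Y) (u : ProjAlgTensor X Y) :
    ‖pairLin T u‖ ≤ ‖T‖ * ‖u‖ := by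
  have key : ∀ l : List (X × Y), ‖pairLin T (ofList l)‖ ≤ ‖T‖ * cost l := by
    intro l
    induction l with
    | nil => simp [ofList, cost]
    | cons p l ih =>
      have h1 : ofList (p :: l) = mk p.1 p.2 + ofList l := by simp [ofList]
      have h2 : cost (p :: l) = ‖p.1‖ * ‖p.2‖ + cost l := by simp [cost]
      rw [h1, h2, map_add, pairLin_mk, mul_add, ← mul_assoc]
      exact (norm_add_le _ _).trans (add_le_add (T.le_opNorm₂ _ _) ih)
  refine le_of_forall_pos_le_add fun ε hε => ?_
  have hT : 0 < ‖T‖ + 1 := by positivity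
  obtain ⟨l, hl, hl'⟩ := exists_cost_lt u (div_pos hε hT)
  have h := key l
  rw [hl] at h
  have h1 : ‖T‖ * cost l ≤ ‖T‖ * (projNorm u + ε / (‖T‖ + 1)) :=
    mul_le_mul_of_nonneg_left hl'.le (norm_nonneg T)
  have h2 : ‖T‖ * (ε / (‖T‖ + 1)) ≤ ε := by
    rw [← mul_div_assoc, div_le_iff₀ hT]
    nlinarith
  rw [norm_eq]
  linarith

/-- The functional `pairLin T` as a bounded functional for the projective norm. -/
def pairCLM (T : X →L[ℝ] StrongDual ℝ Y) : ProjAlgTensor X Y →L[ℝ] ℝ :=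
  (pairLin T).mkContinuous ‖T‖ (norm_pairLin_le T)

end ProjAlgTensor

/-- The projective tensor product `X ⊗̂_π Y`: the completion of `X ⊗ Y` in the projective norm. -/
abbrev ProjTensor (X Y : Type*) [NormedAddCommGroup X] [NormedSpace ℝ X]
    [NormedAddCommGroup Y] [NormedSpace ℝ Y] : Type _ :=
  UniformSpace.Completion (ProjAlgTensor X Y)

section Operators

variable {X Y : Type*} [NormedAddCommGroup X] [NormedSpace ℝ X]
  [NormedAddCommGroup Y] [NormedSpace ℝ Y]

/-- The canonical action of `T ∈ L(X, Y*)` as a functional on `X ⊗̂_π Y`: the continuous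
extension of `∑ xᵢ ⊗ yᵢ ↦ ∑ (T xᵢ)(yᵢ)`. -/
def operatorPairing (T : X →L[ℝ] StrongDual ℝ Y) : ProjTensor X Y →L[ℝ] ℝ :=
  (ProjAlgTensor.pairCLM T).extend
    (UniformSpace.Completion.toComplL : ProjAlgTensor X Y →L[ℝ] ProjTensor X Y)

lemma operatorPairing_coe (T : X →L[ℝ] StrongDual ℝ Y) (u : ProjAlgTensor X Y) :
    operatorPairing T (u : ProjTensor X Y) = ProjAlgTensor.pairLin T u :=
  ContinuousLinearMap.extend_eq (ProjAlgTensor.pairCLM T)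
    (e := (UniformSpace.Completion.toComplL : ProjAlgTensor X Y →L[ℝ] ProjTensor X Y))
    UniformSpace.Completion.denseRange_coe
    (UniformSpace.Completion.isUniformInducing_coe _) u

variable (X Y) in
/-- The compact operators `K(X, Y*)` separate the points of `X ⊗̂_π Y`. -/
def CompactOperatorsSeparate : Prop :=
  ∀ u v : ProjTensor X Y, u ≠ v →
    ∃ T : X →L[ℝ] StrongDual ℝ Y, IsCompactOperator T ∧ operatorPairing T u ≠ operatorPairing T v

/-- The elementary tensor `x ⊗ y` as an element of `L(X, Y*)*`, namely `T ↦ (T x)(y)`. -/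
def elementaryTensor (x : X) (y : Y) : StrongDual ℝ (X →L[ℝ] StrongDual ℝ Y) :=
  (ContinuousLinearMap.apply ℝ ℝ y).comp (ContinuousLinearMap.apply ℝ (StrongDual ℝ Y) x)

/-- The elementary tensor acts on operators as the element `x ⊗ y` of `X ⊗̂_π Y` does. -/
lemma elementaryTensor_apply (x : X) (y : Y) (T : X →L[ℝ] StrongDual ℝ Y) :
    elementaryTensor x y T
      = operatorPairing T ((ProjAlgTensor.mk x y : ProjAlgTensor X Y) : ProjTensor X Y) := by
  rw [operatorPairing_coe, ProjAlgTensor.pairLin_mk]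
  rfl

/-- The elementary tensor `φ ⊗ ψ` of `φ ∈ X**` and `ψ ∈ Y**` as an element of `L(X, Y*)*`,
namely `T ↦ (T** φ)(ψ) = φ (T* ψ) = φ (ψ ∘ T)`. -/
def bidualTensor (φ : StrongDual ℝ (StrongDual ℝ X)) (ψ : StrongDual ℝ (StrongDual ℝ Y)) :
    StrongDual ℝ (X →L[ℝ] StrongDual ℝ Y) :=
  φ.comp (ContinuousLinearMap.compL ℝ X (StrongDual ℝ Y) ℝ ψ)

/-- On the canonical images of `X` and `Y`, `bidualTensor` is the elementary tensor. -/
lemma bidualTensor_inclusion (x : X) (y : Y) :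
    bidualTensor (NormedSpace.inclusionInDoubleDual ℝ X x)
      (NormedSpace.inclusionInDoubleDual ℝ Y y) = elementaryTensor x y := rfl

end Operators

/-! ### Weak*-strongly extreme points -/

section Extreme

variable {E : Type*} [NormedAddCommGroup E] [NormedSpace ℝ E]

/-- The weak*-slice `{f ∈ B_{E*} : f(e) > sup {g(e) : g ∈ B_{E*}} - α}` of the dual unit ball. -/
def weakStarSlice (e : E) (α : ℝ) : Set (StrongDual ℝ E) :=
  {f | f ∈ Metric.closedBall (0 : StrongDual ℝ E) 1 ∧
    f e > sSup ((fun g : StrongDual ℝ E => g e) '' Metric.closedBall (0 : StrongDual ℝ E) 1) - α}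

/-- `f ∈ S_{E*}` is a weak*-strongly extreme point of `B_{E*}`: the weak*-slices of `B_{E*}`
that contain `f` form a local base at `f` for the weak topology `σ(E*, E**)` on `B_{E*}`. -/
def IsWeakStarStronglyExtreme (f : StrongDual ℝ E) : Prop :=
  ‖f‖ = 1 ∧
    (𝓝[toWeakSpace ℝ (StrongDual ℝ E) '' Metric.closedBall (0 : StrongDual ℝ E) 1]
      (toWeakSpace ℝ (StrongDual ℝ E) f)).HasBasis
      (fun p : E × ℝ => 0 < p.2 ∧ f ∈ weakStarSlice p.1 p.2)
      (fun p => toWeakSpace ℝ (StrongDual ℝ E) '' weakStarSlice p.1 p.2)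

variable (E) in
/-- The set of all weak*-strongly extreme points of `B_{E*}`. -/
def weakStarStrext : Set (StrongDual ℝ E) := {f | IsWeakStarStronglyExtreme f}

end Extreme

end

/-! ### Weak*-slices and weak neighbourhoods -/

section Slices

variable {E F : Type*} [NormedAddCommGroup E] [NormedSpace ℝ E]
  [NormedAddCommGroup F] [NormedSpace ℝ F]

/-! Slices through a weak*-strongly extreme point form a weak neighbourhood base, and a norming
subset of the ball meets every slice. So the point lies in the weak closure of each norming set and,
by Mazur, in every norm-closed convex set containing one.

For `z` in the ball of `L(X, Y*)*`, the tensors `x ⊗ y` of ball points are norming. This is used in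
three ways. The isometric copy of `X ⊗̂_π Y` is closed, so it contains `z`. Also `z` is a weak limit
of tensors `xᵢ ⊗ yᵢ`; with `φ`, `ψ` the weak* limits of `xᵢ`, `yᵢ`, compactness of `T` makes `T xᵢ`
converge in norm, so `z T = (φ ⊗ ψ) T` for compact `T`. Finally, testing `z` on rank-one operators
with one factor fixed shows that `φ` and `ψ` come from `X` and `Y`. Then `z` and `x ⊗ y` are two
points of `X ⊗̂_π Y` that agree on compact operators, hence are equal.

Extremality of the factors follows from `IsWeakStarStronglyExtreme.of_comp`, with rank-one operators
providing the left inverse. -/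

lemma sSup_image_closedBall_dual (e : E) :
    sSup ((fun g : StrongDual ℝ E => g e) '' Metric.closedBall (0 : StrongDual ℝ E) 1) = ‖e‖ := by
  refine IsGreatest.csSup_eq ⟨?_, ?_⟩
  · obtain ⟨g, hg, hge⟩ := exists_dual_vector'' ℝ e
    exact ⟨g, by simpa using hg, by simpa using hge⟩
  · rintro _ ⟨g, hg, rfl⟩
    have hg : ‖g‖ ≤ 1 := by simpa using hg
    calc g e ≤ ‖g e‖ := Real.le_norm_self _
      _ ≤ 1 * ‖e‖ := g.le_of_opNorm_le hg e
      _ = ‖e‖ := one_mul _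

lemma mem_weakStarSlice {e : E} {α : ℝ} {f : StrongDual ℝ E} :
    f ∈ weakStarSlice e α ↔ ‖f‖ ≤ 1 ∧ ‖e‖ - α < f e := by
  simp [weakStarSlice, sSup_image_closedBall_dual]

lemma continuous_weakSpace_eval (e : E) :
    Continuous fun g : WeakSpace ℝ (StrongDual ℝ E) =>
      (toWeakSpace ℝ (StrongDual ℝ E)).symm g e :=
  WeakBilin.eval_continuous (topDualPairing ℝ (StrongDual ℝ E)).flip
    (NormedSpace.inclusionInDoubleDual ℝ E e)

/-- Slices are relatively weakly open, so half of the basis property is automatic. -/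
lemma weakStarSlice_mem_nhdsWithin {e : E} {α : ℝ} {f : StrongDual ℝ E}
    (hf : f ∈ weakStarSlice e α) :
    toWeakSpace ℝ (StrongDual ℝ E) '' weakStarSlice e α ∈
      𝓝[toWeakSpace ℝ (StrongDual ℝ E) '' Metric.closedBall (0 : StrongDual ℝ E) 1]
        (toWeakSpace ℝ (StrongDual ℝ E) f) := by
  refine mem_nhdsWithin.2 ⟨_, isOpen_Ioi.preimage (continuous_weakSpace_eval e),
    (mem_weakStarSlice.1 hf).2, ?_⟩
  rintro _ ⟨hg, g, hgB, rfl⟩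
  exact ⟨g, mem_weakStarSlice.2 ⟨by simpa using hgB, hg⟩, rfl⟩

/-- A weak*-strongly extreme point lies in the weak closure of every norming subset of the
dual ball. -/
lemma IsWeakStarStronglyExtreme.mem_closure {f : StrongDual ℝ E}
    (hf : IsWeakStarStronglyExtreme f) {S : Set (StrongDual ℝ E)}
    (hS : ∀ s ∈ S, ‖s‖ ≤ 1) (hnorm : ∀ (e : E) (α : ℝ), 0 < α → ∃ s ∈ S, ‖e‖ - α < s e) :
    toWeakSpace ℝ (StrongDual ℝ E) f ∈ closure (toWeakSpace ℝ (StrongDual ℝ E) '' S) := by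
  refine mem_closure_iff_nhds.2 fun W hW => ?_
  obtain ⟨⟨e, α⟩, ⟨hα, -⟩, hsub⟩ := hf.2.mem_iff.1 (mem_nhdsWithin_of_mem_nhds hW)
  obtain ⟨s, hs, hse⟩ := hnorm e α hα
  exact ⟨_, hsub ⟨s, mem_weakStarSlice.2 ⟨hS s hs, hse⟩, rfl⟩, s, hs, rfl⟩

lemma IsWeakStarStronglyExtreme.mem_of_isClosed_convex {f : StrongDual ℝ E}
    (hf : IsWeakStarStronglyExtreme f) {S M : Set (StrongDual ℝ E)}
    (hS : ∀ s ∈ S, ‖s‖ ≤ 1) (hnorm : ∀ (e : E) (α : ℝ), 0 < α → ∃ s ∈ S, ‖e‖ - α < s e)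
    (hM : IsClosed M) (hMc : Convex ℝ M) (hSM : S ⊆ M) : f ∈ M := by
  have h := closure_mono (Set.image_mono hSM) (hf.mem_closure hS hnorm)
  -- Mazur: a convex set has the same norm and weak closure.
  rw [← hMc.toWeakSpace_closure ℝ, hM.closure_eq] at h
  obtain ⟨g, hg, hgf⟩ := h
  rwa [← (toWeakSpace ℝ (StrongDual ℝ E)).injective hgf]

/-- Weak*-strong extremality passes from `j* f` to `f` if `j` is a contraction and `j*` has a
bounded linear left inverse. -/
lemma IsWeakStarStronglyExtreme.of_comp {f : StrongDual ℝ F} (j : E →L[ℝ] F) (hj : ‖j‖ ≤ 1)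
    (P : StrongDual ℝ E →L[ℝ] StrongDual ℝ F) (hP : ∀ g : StrongDual ℝ F, P (g.comp j) = g)
    (hf : ‖f‖ = 1) (h : IsWeakStarStronglyExtreme (f.comp j)) :
    IsWeakStarStronglyExtreme f := by
  refine ⟨hf, ⟨fun W => ⟨fun hW => ?_, ?_⟩⟩⟩
  · obtain ⟨V, hVo, hfV, hVW⟩ := mem_nhdsWithin.1 hW
    -- `P` is weak-to-weak continuous, so `V` pulls back to a weak neighbourhood of `f.comp j`,
    -- which contains a slice.
    have hV' : (WeakSpace.map P) ⁻¹' V ∈ 𝓝 (toWeakSpace ℝ (StrongDual ℝ E) (f.comp j)) := by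
      refine (hVo.preimage (WeakSpace.map P).continuous).mem_nhds ?_
      change P (f.comp j) ∈ V
      rw [hP]
      exact hfV
    obtain ⟨⟨T, α⟩, ⟨-, hfs⟩, hsub⟩ := h.2.mem_iff.1 (mem_nhdsWithin_of_mem_nhds hV')
    have hfs' := (mem_weakStarSlice.1 hfs).2
    have hjT : ‖j T‖ ≤ ‖T‖ := by simpa using j.le_of_opNorm_le hj T
    have hfj : f (j T) ≤ ‖j T‖ := by
      simpa using (Real.le_norm_self _).trans (f.le_of_opNorm_le hf.le (j T))
    have hfs2 : ‖T‖ - α < f (j T) := hfs'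
    -- This width keeps the threshold at `‖T‖ - α`, so `g` in the new slice puts `g.comp j` in the
    -- old one. It is positive because `‖T‖ - α < f (j T) ≤ ‖j T‖`.
    refine ⟨(j T, α - (‖T‖ - ‖j T‖)), ⟨?_, mem_weakStarSlice.2 ⟨hf.le, ?_⟩⟩, ?_⟩
    · dsimp only
      linarith
    · dsimp only
      linarith
    · rintro _ ⟨g, hg, rfl⟩
      obtain ⟨hg1, hg2⟩ := mem_weakStarSlice.1 hg
      dsimp only at hg2
      refine hVW ⟨?_, g, by simpa using hg1, rfl⟩
      have hgj : ‖g.comp j‖ ≤ 1 :=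
        (g.opNorm_comp_le j).trans (mul_le_one₀ hg1 (norm_nonneg _) hj)
      have hmem : P (g.comp j) ∈ V :=
        hsub ⟨g.comp j, mem_weakStarSlice.2 ⟨hgj, by
          change ‖T‖ - α < g (j T)
          linarith⟩, rfl⟩
      rwa [hP] at hmem
  · rintro ⟨p, ⟨-, hfp⟩, hsub⟩
    exact Filter.mem_of_superset (weakStarSlice_mem_nhdsWithin hfp) hsub

/-! ### The canonical embedding into the bidual. -/

lemma norm_inclusionInDoubleDual (x : E) : ‖NormedSpace.inclusionInDoubleDual ℝ E x‖ = ‖x‖ :=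
  (NormedSpace.inclusionInDoubleDualLi ℝ (E := E)).norm_map x

lemma isClosed_range_inclusionInDoubleDual [CompleteSpace E] :
    IsClosed (Set.range (NormedSpace.inclusionInDoubleDual ℝ E)) := by
  have h : AntilipschitzWith 1 (NormedSpace.inclusionInDoubleDual ℝ E) :=
    (NormedSpace.inclusionInDoubleDualLi ℝ (E := E)).antilipschitz
  exact h.isClosed_range (NormedSpace.inclusionInDoubleDual ℝ E).uniformContinuous

lemma exists_norm_le_one_lt_apply (f : StrongDual ℝ E) {α : ℝ} (hα : 0 < α) :
    ∃ x : E, ‖x‖ ≤ 1 ∧ ‖f‖ - α < f x := by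
  by_contra! h
  have h0 := h 0 (by simp)
  have : ‖f‖ ≤ ‖f‖ - α := by
    refine f.opNorm_le_of_unit_norm (by simpa using h0) fun x hx => ?_
    rcases abs_cases (f x) with ⟨h1, -⟩ | ⟨h1, -⟩
    · rw [Real.norm_eq_abs, h1]; exact h x hx.le
    · rw [Real.norm_eq_abs, h1]; simpa using h (-x) (by simpa using hx.le)
  linarith

/-- A weak*-strongly extreme point of the bidual ball is an element of the space. -/
lemma IsWeakStarStronglyExtreme.exists_inclusion_eq [CompleteSpace E]
    {φ : StrongDual ℝ (StrongDual ℝ E)} (hφ : IsWeakStarStronglyExtreme φ) :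
    ∃ x : E, ‖x‖ = 1 ∧ NormedSpace.inclusionInDoubleDual ℝ E x = φ := by
  have h : φ ∈ Set.range (NormedSpace.inclusionInDoubleDual ℝ E) := by
    refine hφ.mem_of_isClosed_convex
      (S := NormedSpace.inclusionInDoubleDual ℝ E '' Metric.closedBall 0 1) ?_ ?_
      isClosed_range_inclusionInDoubleDual ?_ (Set.image_subset_range _ _)
    · rintro _ ⟨x, hx, rfl⟩
      rw [norm_inclusionInDoubleDual]
      simpa using hx
    · intro e α hα
      obtain ⟨x, hx, hxe⟩ := exists_norm_le_one_lt_apply e hα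
      exact ⟨_, ⟨x, by simpa using hx, rfl⟩, hxe⟩
    · exact (LinearMap.range (NormedSpace.inclusionInDoubleDual ℝ E).toLinearMap).convex
  obtain ⟨x, rfl⟩ := h
  exact ⟨x, by rw [← norm_inclusionInDoubleDual, hφ.1], rfl⟩

/-- Along an ultrafilter carried by the unit ball, points converge weak* in the bidual. -/
lemma exists_bidual_limit {ι : Type*} (U : Ultrafilter ι) {x : ι → E}
    (hx : ∀ᶠ i in U, ‖x i‖ ≤ 1) :
    ∃ φ : StrongDual ℝ (StrongDual ℝ E), ‖φ‖ ≤ 1 ∧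
      ∀ f : StrongDual ℝ E, Filter.Tendsto (fun i => f (x i)) U (𝓝 (φ f)) := by
  let k : ι → WeakDual ℝ (StrongDual ℝ E) := fun i =>
    StrongDual.toWeakDual (NormedSpace.inclusionInDoubleDual ℝ E (x i))
  -- Banach–Alaoglu in the bidual.
  obtain ⟨φ, hφ, hle⟩ := (WeakDual.isCompact_closedBall
    (0 : StrongDual ℝ (StrongDual ℝ E)) 1).ultrafilter_le_nhds (U.map k) (by
      refine Filter.le_principal_iff.2 (Filter.mem_map.2 ?_)
      filter_upwards [hx] with i hi
      have : ‖NormedSpace.inclusionInDoubleDual ℝ E (x i)‖ ≤ 1 := by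
        rwa [norm_inclusionInDoubleDual]
      simpa [k] using this)
  refine ⟨WeakDual.toStrongDual φ, by simpa using hφ, fun f => ?_⟩
  exact ((WeakDual.eval_continuous f).tendsto φ).comp hle

end Slices

/-! ### The projective tensor product inside the dual of the operator space -/

section Tensors

set_option maxSynthPendingDepth 3

variable {X Y : Type*} [NormedAddCommGroup X] [NormedSpace ℝ X]
  [NormedAddCommGroup Y] [NormedSpace ℝ Y]

lemma ProjAlgTensor.norm_mk_le (x : X) (y : Y) : ‖ProjAlgTensor.mk x y‖ ≤ ‖x‖ * ‖y‖ := by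
  have h := ProjAlgTensor.projNorm_le [(x, y)]
  simpa [ProjAlgTensor.ofList, ProjAlgTensor.cost, ProjAlgTensor.norm_eq] using h

lemma ProjAlgTensor.linearMap_ext {f g : ProjAlgTensor X Y →ₗ[ℝ] ℝ}
    (h : ∀ x y, f (ProjAlgTensor.mk x y) = g (ProjAlgTensor.mk x y)) : f = g :=
  TensorProduct.ext' (R := ℝ) (M := X) (N := Y) h

/-- Every bounded functional on `X ⊗̂_π Y` of norm at most one comes from a contraction. -/
lemma exists_operatorPairing_eq (F : StrongDual ℝ (ProjTensor X Y)) (hF : ‖F‖ ≤ 1) :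
    ∃ T : X →L[ℝ] StrongDual ℝ Y, ‖T‖ ≤ 1 ∧ operatorPairing T = F := by
  let B : X →ₗ[ℝ] Y →ₗ[ℝ] ℝ := (TensorProduct.mk ℝ X Y).compr₂
    (F.comp (UniformSpace.Completion.toComplL : ProjAlgTensor X Y →L[ℝ] ProjTensor X Y)).toLinearMap
  have hB : ∀ x y, B x y = F ((ProjAlgTensor.mk x y : ProjAlgTensor X Y) : ProjTensor X Y) :=
    fun _ _ => rfl
  have hbd : ∀ x y, ‖B x y‖ ≤ 1 * ‖x‖ * ‖y‖ := fun x y => by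
    rw [hB, one_mul]
    refine (F.le_of_opNorm_le hF _).trans ?_
    rw [one_mul, UniformSpace.Completion.norm_coe]
    exact ProjAlgTensor.norm_mk_le x y
  refine ⟨B.mkContinuous₂ 1 hbd, B.mkContinuous₂_norm_le zero_le_one hbd, ?_⟩
  ext u
  refine UniformSpace.Completion.induction_on u
    (isClosed_eq (ContinuousLinearMap.continuous _) F.continuous) fun a => ?_
  rw [operatorPairing_coe]
  refine LinearMap.congr_fun (g := (F.comp (UniformSpace.Completion.toComplL :
    ProjAlgTensor X Y →L[ℝ] ProjTensor X Y)).toLinearMap)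
    (ProjAlgTensor.linearMap_ext fun x y => ?_) a
  rw [ProjAlgTensor.pairLin_mk]
  rfl

lemma operatorPairing_add (S T : X →L[ℝ] StrongDual ℝ Y) (u : ProjTensor X Y) :
    operatorPairing (S + T) u = operatorPairing S u + operatorPairing T u := by
  refine UniformSpace.Completion.induction_on u
    (isClosed_eq (operatorPairing (S + T)).continuous
      ((operatorPairing S).continuous.add (operatorPairing T).continuous)) fun a => ?_
  simp only [operatorPairing_coe]
  exact LinearMap.congr_fun (g := ProjAlgTensor.pairLin S + ProjAlgTensor.pairLin T)
    (ProjAlgTensor.linearMap_ext fun x y => by simp [ProjAlgTensor.pairLin_mk]) a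

lemma operatorPairing_smul (c : ℝ) (T : X →L[ℝ] StrongDual ℝ Y) (u : ProjTensor X Y) :
    operatorPairing (c • T) u = c * operatorPairing T u := by
  refine UniformSpace.Completion.induction_on u
    (isClosed_eq (operatorPairing (c • T)).continuous
      (continuous_const.mul (operatorPairing T).continuous)) fun a => ?_
  simp only [operatorPairing_coe]
  exact LinearMap.congr_fun (g := c • ProjAlgTensor.pairLin T)
    (ProjAlgTensor.linearMap_ext fun x y => by simp [ProjAlgTensor.pairLin_mk]) a

lemma norm_operatorPairing_le (T : X →L[ℝ] StrongDual ℝ Y) (u : ProjTensor X Y) :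
    ‖operatorPairing T u‖ ≤ ‖T‖ * ‖u‖ := by
  refine UniformSpace.Completion.induction_on u
    (isClosed_le (operatorPairing T).continuous.norm
      (continuous_const.mul continuous_norm)) fun a => ?_
  rw [operatorPairing_coe, UniformSpace.Completion.norm_coe]
  exact ProjAlgTensor.norm_pairLin_le T a

/-- The element of `L(X, Y*)*` that a point of `X ⊗̂_π Y` defines. -/
noncomputable def tensorFunctional (u : ProjTensor X Y) :
    StrongDual ℝ (X →L[ℝ] StrongDual ℝ Y) :=
  LinearMap.mkContinuous
    { toFun := fun T => operatorPairing T u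
      map_add' := fun S T => operatorPairing_add S T u
      map_smul' := fun c T => operatorPairing_smul c T u } ‖u‖
    fun T => (norm_operatorPairing_le T u).trans_eq (mul_comm _ _)

lemma tensorFunctional_apply (u : ProjTensor X Y) (T : X →L[ℝ] StrongDual ℝ Y) :
    tensorFunctional u T = operatorPairing T u := rfl

/-- A Hahn–Banach functional norming `u` is itself the pairing with a contraction `T`. -/
lemma norm_tensorFunctional (u : ProjTensor X Y) : ‖tensorFunctional u‖ = ‖u‖ := by
  refine le_antisymm (LinearMap.mkContinuous_norm_le _ (norm_nonneg u) _) ?_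
  obtain ⟨F, hF, hFu⟩ := exists_dual_vector'' ℝ u
  obtain ⟨T, hT, rfl⟩ := exists_operatorPairing_eq F hF
  calc ‖u‖ = tensorFunctional u T := by rw [tensorFunctional_apply, hFu]; rfl
    _ ≤ ‖tensorFunctional u T‖ := Real.le_norm_self _
    _ ≤ ‖tensorFunctional u‖ * ‖T‖ := (tensorFunctional u).le_opNorm T
    _ ≤ ‖tensorFunctional u‖ := mul_le_of_le_one_right (norm_nonneg _) hT

variable (X Y) in
/-- The canonical isometric embedding of `X ⊗̂_π Y` into the dual of `L(X, Y*)`. -/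
noncomputable def tensorEmbedding :
    ProjTensor X Y →ₗᵢ[ℝ] StrongDual ℝ (X →L[ℝ] StrongDual ℝ Y) where
  toFun := tensorFunctional
  map_add' u v := by ext T; exact map_add (operatorPairing T) u v
  map_smul' c u := by ext T; exact map_smul (operatorPairing T) c u
  norm_map' := norm_tensorFunctional

lemma tensorEmbedding_apply (u : ProjTensor X Y) (T : X →L[ℝ] StrongDual ℝ Y) :
    tensorEmbedding X Y u T = operatorPairing T u := rfl

lemma tensorEmbedding_mk (x : X) (y : Y) :
    tensorEmbedding X Y ((ProjAlgTensor.mk x y : ProjAlgTensor X Y) : ProjTensor X Y)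
      = elementaryTensor x y := by
  ext T
  rw [tensorEmbedding_apply, elementaryTensor_apply]

lemma norm_elementaryTensor_le (x : X) (y : Y) : ‖elementaryTensor x y‖ ≤ ‖x‖ * ‖y‖ := by
  rw [← tensorEmbedding_mk, LinearIsometry.norm_map, UniformSpace.Completion.norm_coe]
  exact ProjAlgTensor.norm_mk_le x y

/-! ### Elementary tensors as a norming set. -/

lemma exists_lt_elementaryTensor_apply (T : X →L[ℝ] StrongDual ℝ Y) {α : ℝ} (hα : 0 < α) :
    ∃ (x : X) (y : Y), ‖x‖ ≤ 1 ∧ ‖y‖ ≤ 1 ∧ ‖T‖ - α < elementaryTensor x y T := by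
  have h2 : ∃ x : X, ‖x‖ ≤ 1 ∧ ‖T‖ - α / 2 < ‖T x‖ := by
    by_contra! h
    have h0 : 0 ≤ ‖T‖ - α / 2 := by simpa using h 0 (by simp)
    have := T.opNorm_le_of_unit_norm h0 fun x hx => h x hx.le
    linarith
  obtain ⟨x, hx, hxT⟩ := h2
  obtain ⟨y, hy, hyT⟩ := exists_norm_le_one_lt_apply (T x) (half_pos hα)
  refine ⟨x, y, hx, hy, ?_⟩
  change ‖T‖ - α < T x y
  linarith

variable (X Y) in
/-- The elementary tensors of points of the two unit balls. -/
def ballTensors : Set (StrongDual ℝ (X →L[ℝ] StrongDual ℝ Y)) :=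
  (fun p : X × Y => elementaryTensor p.1 p.2) '' {p | ‖p.1‖ ≤ 1 ∧ ‖p.2‖ ≤ 1}

lemma norm_le_one_of_mem_ballTensors {s : StrongDual ℝ (X →L[ℝ] StrongDual ℝ Y)}
    (hs : s ∈ ballTensors X Y) : ‖s‖ ≤ 1 := by
  obtain ⟨p, ⟨h1, h2⟩, rfl⟩ := hs
  exact (norm_elementaryTensor_le _ _).trans (mul_le_one₀ h1 (norm_nonneg _) h2)

lemma ballTensors_norming (T : X →L[ℝ] StrongDual ℝ Y) (α : ℝ) (hα : 0 < α) :
    ∃ s ∈ ballTensors X Y, ‖T‖ - α < s T := by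
  obtain ⟨x, y, hx, hy, h⟩ := exists_lt_elementaryTensor_apply T hα
  exact ⟨_, ⟨(x, y), ⟨hx, hy⟩, rfl⟩, h⟩

lemma IsWeakStarStronglyExtreme.mem_of_elementaryTensor_mem
    {z : StrongDual ℝ (X →L[ℝ] StrongDual ℝ Y)}
    (hz : IsWeakStarStronglyExtreme (E := X →L[ℝ] StrongDual ℝ Y) z)
    {M : Set (StrongDual ℝ (X →L[ℝ] StrongDual ℝ Y))} (hM : IsClosed M) (hMc : Convex ℝ M)
    (h : ∀ x y, elementaryTensor x y ∈ M) : z ∈ M :=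
  hz.mem_of_isClosed_convex (fun _ => norm_le_one_of_mem_ballTensors) ballTensors_norming hM hMc
    (by rintro _ ⟨p, -, rfl⟩; exact h _ _)

/-- On compact operators, a weak*-strongly extreme point acts as an elementary tensor of the
biduals. -/
lemma IsWeakStarStronglyExtreme.exists_bidualTensor_eq_on_compact
    {z : StrongDual ℝ (X →L[ℝ] StrongDual ℝ Y)}
    (hz : IsWeakStarStronglyExtreme (E := X →L[ℝ] StrongDual ℝ Y) z) :
    ∃ (φ : StrongDual ℝ (StrongDual ℝ X)) (ψ : StrongDual ℝ (StrongDual ℝ Y)),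
      ‖φ‖ ≤ 1 ∧ ‖ψ‖ ≤ 1 ∧ ∀ T : X →L[ℝ] StrongDual ℝ Y, IsCompactOperator T →
        z T = bidualTensor φ ψ T := by
  have hcl := hz.mem_closure (fun _ => norm_le_one_of_mem_ballTensors) ballTensors_norming
  rw [ballTensors, Set.image_image] at hcl
  obtain ⟨V, hV, hVz⟩ := mem_closure_iff_ultrafilter.1 hcl
  -- The ultrafilter is lifted from tensors to pairs, so that both coordinates have limits along it.
  let U : Ultrafilter (X × Y) := Ultrafilter.ofComapInfPrincipal hV
  have hU : {p : X × Y | ‖p.1‖ ≤ 1 ∧ ‖p.2‖ ≤ 1} ∈ U := Ultrafilter.ofComapInfPrincipal_mem hV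
  rw [← Ultrafilter.ofComapInfPrincipal_eq_of_map hV] at hVz
  have hzlim : ∀ T : X →L[ℝ] StrongDual ℝ Y,
      Filter.Tendsto (fun p : X × Y => T p.1 p.2) U (𝓝 (z T)) := fun T =>
    ((continuous_weakSpace_eval T).tendsto _).comp hVz
  obtain ⟨φ, hφ, hφlim⟩ := exists_bidual_limit U (x := Prod.fst)
    (Filter.mem_of_superset hU fun p hp => hp.1)
  obtain ⟨ψ, hψ, hψlim⟩ := exists_bidual_limit U (x := Prod.snd)
    (Filter.mem_of_superset hU fun p hp => hp.2)
  refine ⟨φ, ψ, hφ, hψ, fun T hT => ?_⟩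
  -- Compactness of `T` gives a norm limit `g` of `T p.1`. Norm convergence allows replacing `T p.1`
  -- by `g` uniformly over `p.2` in the ball.
  obtain ⟨g, -, hg⟩ := (hT.isCompact_closure_image_closedBall 1).ultrafilter_le_nhds
    (U.map fun p => T p.1) (by
      refine Filter.le_principal_iff.2 (Filter.mem_map.2 ?_)
      filter_upwards [hU] with p hp
      exact subset_closure ⟨p.1, by simpa using hp.1, rfl⟩)
  have hg : Filter.Tendsto (fun p : X × Y => T p.1) U (𝓝 g) := hg
  have h1 : bidualTensor φ ψ T = ψ g :=
    tendsto_nhds_unique (hφlim (ψ.comp T)) ((ψ.continuous.tendsto g).comp hg)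
  have h2 : z T = ψ g := by
    refine tendsto_nhds_unique (hzlim T) ?_
    have h0 : Filter.Tendsto (fun p : X × Y => (T p.1 - g) p.2) U (𝓝 0) := by
      refine squeeze_zero_norm' (a := fun p => ‖T p.1 - g‖) ?_ ?_
      · filter_upwards [hU] with p hp
        exact ((T p.1 - g).le_opNorm p.2).trans
          (mul_le_of_le_one_right (norm_nonneg _) hp.2)
      · simpa using (hg.sub_const g).norm
    simpa using h0.add (hψlim g)
  rw [h1, h2]

lemma isCompactOperator_smulRight (f : StrongDual ℝ X) (g : StrongDual ℝ Y) :
    IsCompactOperator (f.smulRight g : X →L[ℝ] StrongDual ℝ Y) := by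
  have hK : IsCompactOperator f := by
    refine ⟨Metric.closedBall 0 1, isCompact_closedBall 0 1, ?_⟩
    exact f.continuous.continuousAt.preimage_mem_nhds
      (by simpa using Metric.closedBall_mem_nhds (0 : ℝ) one_pos)
  exact hK.clm_comp ((ContinuousLinearMap.id ℝ ℝ).smulRight g)

/-- A weak*-strongly extreme point of the ball of `L(X, Y*)*` is an elementary tensor, provided
the compact operators separate the points of `X ⊗̂_π Y`. -/
lemma IsWeakStarStronglyExtreme.exists_eq_elementaryTensor [CompleteSpace X] [CompleteSpace Y]
    (hsep : CompactOperatorsSeparate X Y) {z : StrongDual ℝ (X →L[ℝ] StrongDual ℝ Y)}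
    (hz : IsWeakStarStronglyExtreme (E := X →L[ℝ] StrongDual ℝ Y) z) :
    ∃ (x : X) (y : Y), ‖x‖ = 1 ∧ ‖y‖ = 1 ∧ z = elementaryTensor x y := by
  obtain ⟨φ, ψ, hφ, hψ, hK⟩ := hz.exists_bidualTensor_eq_on_compact
  obtain ⟨u, hu⟩ : z ∈ Set.range (tensorEmbedding X Y) :=
    hz.mem_of_elementaryTensor_mem ((tensorEmbedding X Y).antilipschitz.isClosed_range
        (tensorEmbedding X Y).isometry.uniformContinuous)
      (LinearMap.range (tensorEmbedding X Y).toLinearMap).convex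
      fun x y => ⟨_, tensorEmbedding_mk x y⟩
  have hz0 : z ≠ 0 := fun h => by simpa [h] using hz.1
  have huniq : ∀ v : ProjTensor X Y, (∀ T : X →L[ℝ] StrongDual ℝ Y, IsCompactOperator T →
      bidualTensor φ ψ T = operatorPairing T v) → u = v := fun v hv => by
    by_contra huv
    obtain ⟨T, hT, hne⟩ := hsep u v huv
    exact hne (by rw [← tensorEmbedding_apply, hu, hK T hT, hv T hT])
  -- Otherwise `z` would vanish on all compact operators, and separation would force `z = 0`.
  -- Nonzero values of `φ` and `ψ` are needed for the divisions below.
  have hne : ∃ T, bidualTensor φ ψ T ≠ 0 := by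
    by_contra! h
    have h0 := huniq 0 fun T _ => by rw [h T, map_zero]
    exact hz0 (by rw [← hu, h0, map_zero])
  have hφ0 : ∃ f, φ f ≠ 0 := by
    obtain ⟨T, hT⟩ := hne
    exact ⟨_, hT⟩
  have hψ0 : ∃ g, ψ g ≠ 0 := by
    by_contra! h
    obtain ⟨T, hT⟩ := hne
    have : ψ = 0 := ContinuousLinearMap.ext h
    exact hT (by simp [bidualTensor, this])
  have hval : ∀ f g, z (f.smulRight g) = φ f * ψ g := fun f g => by
    rw [hK _ (isCompactOperator_smulRight f g)]
    have : ψ.comp (f.smulRight g : X →L[ℝ] StrongDual ℝ Y) = ψ g • f := by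
      ext x
      simp [mul_comm]
    change φ (ψ.comp (f.smulRight g : X →L[ℝ] StrongDual ℝ Y)) = _
    rw [this, map_smul, smul_eq_mul, mul_comm]
  obtain ⟨x, hx⟩ : φ ∈ Set.range (NormedSpace.inclusionInDoubleDual ℝ X) := by
    obtain ⟨g, hg⟩ := hψ0
    let L : StrongDual ℝ X →L[ℝ] X →L[ℝ] StrongDual ℝ Y :=
      (ContinuousLinearMap.smulRightL ℝ X (StrongDual ℝ Y)).flip g
    -- Restriction along `f ↦ f.smulRight g` sends `x ⊗ y` to `g y • x` in `X`. The preimage of `X`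
    -- is thus a closed subspace containing all elementary tensors, and `z` restricts to `ψ g • φ`.
    obtain ⟨x, hx⟩ : z ∈ (ContinuousLinearMap.precomp ℝ L) ⁻¹'
        Set.range (NormedSpace.inclusionInDoubleDual ℝ X) :=
      hz.mem_of_elementaryTensor_mem
        (isClosed_range_inclusionInDoubleDual.preimage (ContinuousLinearMap.continuous _))
        ((LinearMap.range (NormedSpace.inclusionInDoubleDual ℝ X).toLinearMap).convex.linear_preimage
          (ContinuousLinearMap.precomp ℝ L).toLinearMap)
        fun x y => ⟨g y • x, by
          ext f
          change f (g y • x) = (f x • g) y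
          simp [mul_comm]⟩
    refine ⟨(ψ g)⁻¹ • x, ?_⟩
    ext f
    have hxf : f x = φ f * ψ g := by
      rw [← hval]
      exact DFunLike.congr_fun hx f
    rw [NormedSpace.dual_def, map_smul, hxf, smul_eq_mul]
    field_simp
  obtain ⟨y, hy⟩ : ψ ∈ Set.range (NormedSpace.inclusionInDoubleDual ℝ Y) := by
    obtain ⟨f, hf⟩ := hφ0
    let L : StrongDual ℝ Y →L[ℝ] X →L[ℝ] StrongDual ℝ Y :=
      ContinuousLinearMap.smulRightL ℝ X (StrongDual ℝ Y) f
    obtain ⟨y, hy⟩ : z ∈ (ContinuousLinearMap.precomp ℝ L) ⁻¹'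
        Set.range (NormedSpace.inclusionInDoubleDual ℝ Y) :=
      hz.mem_of_elementaryTensor_mem
        (isClosed_range_inclusionInDoubleDual.preimage (ContinuousLinearMap.continuous _))
        ((LinearMap.range (NormedSpace.inclusionInDoubleDual ℝ Y).toLinearMap).convex.linear_preimage
          (ContinuousLinearMap.precomp ℝ L).toLinearMap)
        fun x y => ⟨f x • y, by
          ext g
          change g (f x • y) = (f x • g) y
          simp⟩
    refine ⟨(φ f)⁻¹ • y, ?_⟩
    ext g
    have hyg : g y = φ f * ψ g := by
      rw [← hval]
      exact DFunLike.congr_fun hy g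
    rw [NormedSpace.dual_def, map_smul, hyg, smul_eq_mul]
    field_simp
  have hzxy : z = elementaryTensor x y := by
    rw [← hu, ← tensorEmbedding_mk]
    congr 1
    refine huniq _ fun T _ => ?_
    rw [← elementaryTensor_apply, ← bidualTensor_inclusion, hx, hy]
  have hx1 : ‖x‖ ≤ 1 := by rwa [← norm_inclusionInDoubleDual, hx]
  have hy1 : ‖y‖ ≤ 1 := by rwa [← norm_inclusionInDoubleDual, hy]
  have hprod : 1 ≤ ‖x‖ * ‖y‖ := by
    rw [← hz.1, hzxy]
    exact norm_elementaryTensor_le x y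
  -- Two numbers in `[0, 1]` with product at least `1` both equal `1`.
  exact ⟨x, y, by nlinarith [norm_nonneg x, norm_nonneg y],
    by nlinarith [norm_nonneg x, norm_nonneg y], hzxy⟩

/-- The tensor `x ⊗ y` is `x` composed with the contraction sending `T` to `a ↦ T a y`. If `g y =
1`, the map `f ↦ f.smulRight g` is a right inverse of this contraction, and its adjoint is the
required left inverse. -/
lemma IsWeakStarStronglyExtreme.left_of_elementaryTensor {x : X} {y : Y} (hx : ‖x‖ = 1)
    (hy : ‖y‖ = 1)
    (h : IsWeakStarStronglyExtreme (E := X →L[ℝ] StrongDual ℝ Y) (elementaryTensor x y)) :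
    IsWeakStarStronglyExtreme (NormedSpace.inclusionInDoubleDual ℝ X x) := by
  obtain ⟨g, -, hg⟩ := exists_dual_vector ℝ y (by simp [hy])
  refine IsWeakStarStronglyExtreme.of_comp
    (ContinuousLinearMap.compL ℝ X (StrongDual ℝ Y) ℝ (NormedSpace.inclusionInDoubleDual ℝ Y y))
    (ContinuousLinearMap.opNorm_le_bound _ zero_le_one fun T => ?_)
    (ContinuousLinearMap.precomp ℝ ((ContinuousLinearMap.smulRightL ℝ X (StrongDual ℝ Y)).flip g))
    (fun φ => ?_) (by rw [norm_inclusionInDoubleDual, hx]) h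
  · refine (ContinuousLinearMap.opNorm_comp_le _ T).trans_eq ?_
    rw [norm_inclusionInDoubleDual, hy]
  · ext f
    change φ ((NormedSpace.inclusionInDoubleDual ℝ Y y).comp
      (f.smulRight g : X →L[ℝ] StrongDual ℝ Y)) = φ f
    congr 1
    ext a
    change f a * g y = f a
    simp [hg, hy]

/-- The same argument with evaluation at `x` as the contraction and `g ↦ f.smulRight g`, where `f x
= 1`, as its right inverse. -/
lemma IsWeakStarStronglyExtreme.right_of_elementaryTensor {x : X} {y : Y} (hx : ‖x‖ = 1)
    (hy : ‖y‖ = 1)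
    (h : IsWeakStarStronglyExtreme (E := X →L[ℝ] StrongDual ℝ Y) (elementaryTensor x y)) :
    IsWeakStarStronglyExtreme (NormedSpace.inclusionInDoubleDual ℝ Y y) := by
  obtain ⟨f, -, hf⟩ := exists_dual_vector ℝ x (by simp [hx])
  refine IsWeakStarStronglyExtreme.of_comp (ContinuousLinearMap.apply ℝ (StrongDual ℝ Y) x)
    (ContinuousLinearMap.opNorm_le_bound _ zero_le_one fun T => ?_)
    (ContinuousLinearMap.precomp ℝ (ContinuousLinearMap.smulRightL ℝ X (StrongDual ℝ Y) f))
    (fun ψ => ?_) (by rw [norm_inclusionInDoubleDual, hy]) h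
  · simpa [hx] using T.le_opNorm x
  · ext g
    change ψ (f x • g) = ψ g
    simp [hf, hx]

end Tensors


theorem corollary3p5 {X Y : Type*}
    [NormedAddCommGroup X] [NormedSpace ℝ X] [CompleteSpace X]
    [NormedAddCommGroup Y] [NormedSpace ℝ Y] [CompleteSpace Y]
    (hsep : CompactOperatorsSeparate X Y) :
    (∀ z : StrongDual ℝ (X →L[ℝ] StrongDual ℝ Y),
      IsWeakStarStronglyExtreme (E := X →L[ℝ] StrongDual ℝ Y) z →
      ∃ (x : X) (y : Y), ‖x‖ = 1 ∧ ‖y‖ = 1 ∧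
        IsWeakStarStronglyExtreme (NormedSpace.inclusionInDoubleDual ℝ X x) ∧
        IsWeakStarStronglyExtreme (NormedSpace.inclusionInDoubleDual ℝ Y y) ∧
        z = elementaryTensor x y) ∧
    weakStarStrext (X →L[ℝ] StrongDual ℝ Y) ⊆
      Set.image2 bidualTensor (weakStarStrext (StrongDual ℝ X))
        (weakStarStrext (StrongDual ℝ Y)) ∧
    Set.image2 bidualTensor (weakStarStrext (StrongDual ℝ X))
        (weakStarStrext (StrongDual ℝ Y)) ⊆
      Set.image2 (elementaryTensor : X → Y → StrongDual ℝ (X →L[ℝ] StrongDual ℝ Y))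
        (Metric.closedBall 0 1) (Metric.closedBall 0 1) := by
  have main : ∀ z : StrongDual ℝ (X →L[ℝ] StrongDual ℝ Y),
      IsWeakStarStronglyExtreme (E := X →L[ℝ] StrongDual ℝ Y) z →
      ∃ (x : X) (y : Y), ‖x‖ = 1 ∧ ‖y‖ = 1 ∧
        IsWeakStarStronglyExtreme (NormedSpace.inclusionInDoubleDual ℝ X x) ∧
        IsWeakStarStronglyExtreme (NormedSpace.inclusionInDoubleDual ℝ Y y) ∧
        z = elementaryTensor x y := by
    intro z hz
    obtain ⟨x, y, hx, hy, rfl⟩ := hz.exists_eq_elementaryTensor hsep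
    exact ⟨x, y, hx, hy, hz.left_of_elementaryTensor hx hy, hz.right_of_elementaryTensor hx hy, rfl⟩
  refine ⟨main, fun z hz => ?_, ?_⟩
  · obtain ⟨x, y, -, -, hx, hy, rfl⟩ := main z hz
    exact ⟨_, hx, _, hy, bidualTensor_inclusion x y⟩
  · rintro _ ⟨φ, hφ, ψ, hψ, rfl⟩
    obtain ⟨x, hx, rfl⟩ := IsWeakStarStronglyExtreme.exists_inclusion_eq hφ
    obtain ⟨y, hy, rfl⟩ := IsWeakStarStronglyExtreme.exists_inclusion_eq hψ
    exact ⟨x, by simp [hx], y, by simp [hy], (bidualTensor_inclusion x y).symm⟩
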